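/- Let $M$ be an atomic von Neumann algebra on a complex Hilbert space $H$, that is, $M\subseteq B(H)$ is a von Neumann algebra that coincides with the weak$^*$ (ultraweak) closure of the linear span of its minimal projections, where a non-zero projection $p\in M$ is called minimal if $pMp=\mathbb{C}p$. Let $S(M^+)$ denote the set of all positive norm-one elements of $M$, and for a subset $E\subseteq M$ put $$Sph^+_M(E)=\{x\in S(M^+) : \|x-b\|=1 \text{ for all } b\in E\},\qquad Sph^+_M(a)=Sph^+_M(\{a\}).$$ Let $a$ be a positive norm-one element of $M$. Then the following statements are equivalent: (a) $a$ is a projection (i.e. $a=a^*=a^2$); (b) $Sph^+_M\bigl(Sph^+_M(a)\bigr)=\{a\}$. -/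

import Mathlib

open scoped Topology InnerProductSpace

/-- The unit sphere around `E` in `P`, for subsets `E`, `P` of a normed space. -/
def unitSphereAround {X : Type*} [NormedAddCommGroup X] (E P : Set X) : Set X :=
  {x | x ∈ P ∧ ∀ b ∈ E, ‖x - b‖ = 1}

/-- The ultraweak (σ-weak) topology on the bounded operators on a Hilbert space `H`, that is, the
weak-* topology given by the trace class operators: the coarsest topology making all functionals
`x ↦ ∑ₙ ⟪ξₙ, x ηₙ⟫` continuous, with `ξ`, `η` square-summable sequences in `H`. Its restriction to
a von Neumann algebra on `H` is the weak-* topology of that algebra. -/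
@[reducible] noncomputable def ultraweakTopology (H : Type*) [NormedAddCommGroup H] [InnerProductSpace ℂ H] :
    TopologicalSpace (H →L[ℂ] H) :=
  ⨅ (ξ : lp (fun _ : ℕ => H) 2) (η : lp (fun _ : ℕ => H) 2),
    TopologicalSpace.induced (fun x : H →L[ℂ] H => ∑' n, ⟪ξ n, x (η n)⟫_ℂ) inferInstance

namespace VonNeumannAlgebra

variable {H : Type*} [NormedAddCommGroup H] [InnerProductSpace ℂ H] [CompleteSpace H]

/-- `S(M⁺)`: the positive norm-one elements of `M`. -/
def positiveUnitSphere (M : VonNeumannAlgebra H) : Set (H →L[ℂ] H) :=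
  {x | x ∈ M ∧ 0 ≤ x ∧ ‖x‖ = 1}

/-- `Sph⁺_M(E)`: the unit sphere around `E` in the set of positive norm-one elements of `M`. -/
def sphPos (M : VonNeumannAlgebra H) (E : Set (H →L[ℂ] H)) : Set (H →L[ℂ] H) :=
  unitSphereAround E M.positiveUnitSphere

/-- A minimal projection of `M`: a non-zero projection `p` in `M` such that `p M p = ℂ p`. -/
structure IsMinimalProjection (M : VonNeumannAlgebra H) (p : H →L[ℂ] H) : Prop where
  mem : p ∈ M
  isStarProjection : IsStarProjection p
  ne_zero : p ≠ 0
  corner_eq : (fun x => p * x * p) '' (M : Set (H →L[ℂ] H)) = Set.range fun c : ℂ => c • p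

/-- `M` is atomic: it is the weak-* closure of the linear span of its minimal projections. -/
def IsAtomic (M : VonNeumannAlgebra H) : Prop :=
  (M : Set (H →L[ℂ] H)) =
    closure[ultraweakTopology H] (Submodule.span ℂ {p | M.IsMinimalProjection p})

end VonNeumannAlgebra

/-! If `0 ≤ x ≤ 1` and `‖x - a‖ = 1`, then `‖x - a ^ 2‖ = 1` (`norm_sub_sq_eq_one`). So `a ^ 2`
always lies in the double sphere, and (b) forces `a ^ 2 = a`. Conversely, let `y` be in the double
sphere of a projection `p`, and test it against the elements `halfStep e q` of the sphere of `p`.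
With `q = 0` they show that `y` kills every minimal `e` under `1 - p`, so `y * p = y` by atomicity.
With minimal `q ≤ p` and `e ⟂ q`, either `y * q = q` or `y * e = 0`. If `y * q ≠ q` for some `q`,
then `y` kills `p - q`, which leaves `y = q`, a contradiction. Hence `1 - y` kills every minimal `q
≤ p`, and `y = p`. -/

open ContinuousLinearMap

/-! ### Norms and invertibility in the order interval `[0, 1]` of a C⋆-algebra. -/

section CStarAlgebra

variable {A : Type*} [CStarAlgebra A]

lemma IsSelfAdjoint.not_isUnit_and_isUnit_of_norm_eq_one [Nontrivial A] {t : A}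
    (ht : IsSelfAdjoint t) (h : ‖t‖ = 1) : ¬ (IsUnit (1 - t) ∧ IsUnit (1 + t)) := by
  rintro ⟨h₁, h₂⟩
  rcases CStarAlgebra.norm_or_neg_norm_mem_spectrum (a := t) ht with h' | h'
  · rw [h, spectrum.mem_iff, map_one] at h'
    exact h' h₁
  · rw [h, spectrum.mem_iff, map_neg, map_one, ← neg_add', IsUnit.neg_iff] at h'
    exact h' h₂

/-- The operator equal to `1` on `e`, to `0` on `q` and to `1 / 2` elsewhere. -/
noncomputable def halfStep (e q : A) : A := e + (1 / 2 : ℝ) • (1 - q - e)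

lemma halfStep_mul_left {e q : A} (he : IsStarProjection e) (hqe : q * e = 0) :
    halfStep e q * e = e := by
  simp [halfStep, add_mul, sub_mul, hqe, he.isIdempotentElem.eq]

lemma halfStep_mul_right {e q : A} (hq : IsStarProjection q) (heq : e * q = 0) :
    halfStep e q * q = 0 := by
  simp [halfStep, add_mul, sub_mul, heq, hq.isIdempotentElem.eq]

lemma one_sub_halfStep (e q : A) : 1 - halfStep e q = (1 / 2 : ℝ) • (1 - e) + (1 / 2 : ℝ) • q := by
  rw [halfStep]; module

lemma one_le_norm_of_mul_eq {t e : A} (he : e ≠ 0) (h : t * e = e) : 1 ≤ ‖t‖ := by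
  have h1 : ‖e‖ ≤ ‖t‖ * ‖e‖ := by
    calc ‖e‖ = ‖t * e‖ := by rw [h]
      _ ≤ _ := norm_mul_le _ _
  exact (le_mul_iff_one_le_left (norm_pos_iff.2 he)).1 h1

variable [PartialOrder A] [StarOrderedRing A]

lemma isUnit_of_isUnit_of_le {s t : A} (hs : 0 ≤ s) (hu : IsUnit s) (h : s ≤ t) : IsUnit t :=
  CStarAlgebra.isUnit_of_le s h ⟨hs, hu⟩

lemma norm_sub_le_one {x y : A} (hx : 0 ≤ x) (hx₁ : x ≤ 1) (hy : 0 ≤ y) (hy₁ : y ≤ 1) :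
    ‖x - y‖ ≤ 1 := by
  rcases subsingleton_or_nontrivial A with _ | _
  · simp [Subsingleton.elim (x - y) 0]
  have hsa : IsSelfAdjoint (x - y) := hx.isSelfAdjoint.sub hy.isSelfAdjoint
  have key : ∀ r : ℝ, r ∈ spectrum ℝ (x - y) → r ≤ 1 ∧ -1 ≤ r := by
    intro r hr
    constructor
    · refine (le_algebraMap_iff_spectrum_le (a := x - y) (r := (1 : ℝ)) hsa).1 ?_ r hr
      rw [map_one]
      exact (sub_le_self x hy).trans hx₁
    · refine (algebraMap_le_iff_le_spectrum (a := x - y) (r := (-1 : ℝ)) hsa).1 ?_ r hr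
      rw [map_neg, map_one, neg_le_sub_iff_le_add]
      exact hy₁.trans (le_add_of_nonneg_left hx)
  rcases CStarAlgebra.norm_or_neg_norm_mem_spectrum (a := x - y) hsa with h | h
  · exact (key _ h).1
  · linarith [(key _ h).2]

/-- If `‖x - a ^ 2‖ < 1`, then `1 ± (x - a ^ 2)` are invertible; order comparison makes `1 ± (x -
a)` invertible too, so neither `1` nor `-1` is in the spectrum of `x - a`. -/
lemma norm_sub_sq_eq_one {x a : A} (hx : 0 ≤ x) (hx₁ : x ≤ 1) (ha : 0 ≤ a) (ha₁ : a ≤ 1)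
    (h : ‖x - a‖ = 1) : ‖x - a ^ 2‖ = 1 := by
  have : Nontrivial A := by
    by_contra hA
    rw [not_nontrivial_iff_subsingleton] at hA
    simp [Subsingleton.elim (x - a) 0] at h
  have hsq : 0 ≤ a ^ 2 := CStarAlgebra.pow_nonneg ha 2
  have hsq_le : a ^ 2 ≤ a := by simpa using CStarAlgebra.pow_antitone ha ha₁ one_le_two
  have hle : ‖x - a ^ 2‖ ≤ 1 := norm_sub_le_one hx hx₁ hsq (hsq_le.trans ha₁)
  refine hle.antisymm (not_lt.1 fun hlt => ?_)
  refine (hx.isSelfAdjoint.sub ha.isSelfAdjoint).not_isUnit_and_isUnit_of_norm_eq_one h ⟨?_, ?_⟩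
  · refine isUnit_of_isUnit_of_le (s := 1 - (x - a ^ 2)) ?_ (isUnit_one_sub_of_norm_lt_one hlt) ?_
    · rw [sub_nonneg]
      exact (sub_le_self x hsq).trans hx₁
    · gcongr
  · have hu : IsUnit (1 - (a ^ 2 - x)) :=
      isUnit_one_sub_of_norm_lt_one (by rwa [norm_sub_rev])
    have hu₂ : IsUnit ((2 : ℝ) • (1 + (x - a))) := by
      refine isUnit_of_isUnit_of_le (s := 1 - (a ^ 2 - x)) ?_ hu ?_
      · rw [sub_nonneg]
        exact (sub_le_self _ hx).trans (hsq_le.trans ha₁)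
      · rw [← sub_nonneg]
        have : (2 : ℝ) • (1 + (x - a)) - (1 - (a ^ 2 - x)) = x + (1 - a) ^ 2 := by
          rw [two_smul]; noncomm_ring
        rw [this]
        exact add_nonneg hx (CStarAlgebra.pow_nonneg (sub_nonneg.2 ha₁) 2)
    obtain ⟨u, hu'⟩ : IsUnit (algebraMap ℝ A 2) := (IsUnit.mk0 (2 : ℝ) two_ne_zero).map _
    rwa [Algebra.smul_def, ← hu', Units.isUnit_units_mul] at hu₂

/-- With `s` the square root of `y`, `e * y * e = star (s * e) * (s * e)`. -/
lemma nonneg_mul_eq_zero_of_conj_eq_zero {y e : A} (hy : 0 ≤ y) (he : IsSelfAdjoint e)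
    (h : e * y * e = 0) : y * e = 0 := by
  obtain ⟨s, hs, rfl⟩ : ∃ s : A, IsSelfAdjoint s ∧ y = s * s :=
    ⟨CFC.sqrt y, (CFC.sqrt_nonneg y).isSelfAdjoint, (CFC.sqrt_mul_sqrt_self y).symm⟩
  have : s * e = 0 := by
    rw [← CStarRing.star_mul_self_eq_zero_iff, star_mul, hs.star_eq, he.star_eq, ← h]
    noncomm_ring
  rw [mul_assoc, this, mul_zero]

lemma halfStep_nonneg {e q : A} (he : IsStarProjection e) (hq : IsStarProjection q)
    (hqe : q * e = 0) : 0 ≤ halfStep e q := by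
  have h : (1 - q - e) = (1 - (q + e)) := by abel
  have := (hq.add he hqe).one_sub_nonneg
  rw [halfStep, h]
  exact add_nonneg he.nonneg (smul_nonneg (by norm_num) this)

lemma halfStep_le_one {e q : A} (he : IsStarProjection e) (hq : IsStarProjection q) :
    halfStep e q ≤ 1 := by
  rw [← sub_nonneg, one_sub_halfStep]
  exact add_nonneg (smul_nonneg (by norm_num) he.one_sub_nonneg)
    (smul_nonneg (by norm_num) hq.nonneg)

end CStarAlgebra

/-! ### Invertibility and ultraweak closedness in `B(H)`. -/

section Operator

variable {H : Type*} [NormedAddCommGroup H] [InnerProductSpace ℂ H] [CompleteSpace H]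

lemma norm_apply_le_of_isStarProjection {q : H →L[ℂ] H} (hq : IsStarProjection q) (ξ : H) :
    ‖q ξ‖ ≤ ‖ξ‖ := by
  have : ‖q‖ ≤ 1 := (CStarAlgebra.norm_le_one_iff_of_nonneg q hq.nonneg).2 hq.le_one
  simpa using q.le_of_opNorm_le this ξ

lemma norm_apply_sq_le_re_inner {t : H →L[ℂ] H} (h₀ : 0 ≤ t) (h₁ : t ≤ 1) (ξ : H) :
    ‖t ξ‖ ^ 2 ≤ (⟪t ξ, ξ⟫_ℂ).re := by
  have h : t ^ 2 ≤ t := by simpa using CStarAlgebra.pow_antitone h₀ h₁ one_le_two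
  have h2 := ((le_def _ _).1 h).re_inner_nonneg_left ξ
  have h3 : ⟪(t ^ 2) ξ, ξ⟫_ℂ = ⟪t ξ, t ξ⟫_ℂ := by
    rw [pow_two]
    exact ((nonneg_iff_isPositive t).1 h₀).inner_left_eq_inner_right _ _
  rw [sub_apply, inner_sub_left, h3, inner_self_eq_norm_sq_to_K] at h2
  simp only [map_sub] at h2
  norm_cast at h2
  simpa using h2

/-- The quadratic form is bounded below: `1 - q` controls vectors off the range of `q`, and the
non-zero corner of `t` controls those in it. -/
lemma isUnit_add_half_one_sub {t q : H →L[ℂ] H} (h₀ : 0 ≤ t) (h₁ : t ≤ 1)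
    (hq : IsStarProjection q) {d : ℂ} (hd : d ≠ 0) (hqt : q * t * q = d • q) :
    IsUnit (t + (1 / 2 : ℝ) • (1 - q)) := by
  set k := ‖d‖ with hk
  have hk0 : 0 < k := norm_pos_iff.2 hd
  -- This constant comes from squaring `e3` with `(u + v) ^ 2 ≤ 2 * u ^ 2 + 2 * v ^ 2`.
  set δ : ℝ := k ^ 2 / (4 * (1 + k) ^ 2) with hδ
  have hδ0 : 0 < δ := by positivity
  refine isUnit_of_forall_le_norm_inner_map _ (c := ⟨δ, hδ0.le⟩) hδ0 fun ξ => ?_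
  have ht : ‖t‖ ≤ 1 := (CStarAlgebra.norm_le_one_iff_of_nonneg t h₀).2 h₁
  set w := (1 - q) ξ with hw
  have hξ : ξ = q ξ + w := by simp [hw]
  have e1 : ‖ξ‖ ≤ ‖q ξ‖ + ‖w‖ := by
    conv_lhs => rw [hξ]
    exact norm_add_le _ _
  have e2 : k * ‖q ξ‖ ≤ ‖t ξ‖ + ‖w‖ := by
    have h3 : d • q ξ = q (t ξ) - q (t w) := by
      have h4 : q (t (q ξ)) = d • q ξ := congr($hqt ξ)
      rw [← h4, ← map_sub, ← map_sub, ← eq_sub_of_add_eq hξ.symm]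
    calc k * ‖q ξ‖ = ‖d • q ξ‖ := by rw [norm_smul]
      _ ≤ ‖q (t ξ)‖ + ‖q (t w)‖ := by rw [h3]; exact norm_sub_le _ _
      _ ≤ ‖t ξ‖ + ‖t w‖ := add_le_add (norm_apply_le_of_isStarProjection hq _)
          (norm_apply_le_of_isStarProjection hq _)
      _ ≤ ‖t ξ‖ + ‖w‖ := by
          gcongr
          simpa using t.le_of_opNorm_le ht w
  have e3 : k * ‖ξ‖ ≤ ‖t ξ‖ + (1 + k) * ‖w‖ := by nlinarith
  have e4 : ‖ξ‖ ^ 2 * δ ≤ ‖t ξ‖ ^ 2 + 1 / 2 * ‖w‖ ^ 2 := by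
    rw [hδ, mul_div_assoc', div_le_iff₀ (by positivity)]
    have h4 : (k * ‖ξ‖) ^ 2 ≤ (‖t ξ‖ + (1 + k) * ‖w‖) ^ 2 := by gcongr
    have h5 := sq_nonneg (‖t ξ‖ - (1 + k) * ‖w‖)
    have h6 : ‖t ξ‖ ^ 2 ≤ (1 + k) ^ 2 * ‖t ξ‖ ^ 2 :=
      le_mul_of_one_le_left (by positivity) (one_le_pow₀ (by linarith))
    nlinarith
  have e5 : ‖w‖ ^ 2 ≤ (⟪w, ξ⟫_ℂ).re :=
    norm_apply_sq_le_re_inner hq.one_sub_nonneg hq.one_sub.le_one ξ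
  have e6 := norm_apply_sq_le_re_inner h₀ h₁ ξ
  calc ‖ξ‖ ^ 2 * δ ≤ (⟪t ξ, ξ⟫_ℂ).re + 1 / 2 * (⟪w, ξ⟫_ℂ).re := by linarith
    _ = (⟪(t + (1 / 2 : ℝ) • (1 - q)) ξ, ξ⟫_ℂ).re := by
      rw [add_apply, smul_apply, inner_add_left, inner_smul_left_eq_smul, Complex.add_re,
        Complex.smul_re, smul_eq_mul]
    _ ≤ _ := Complex.re_le_norm _

/-- If `y` is at distance one from `halfStep e q`, then one of the corners of `1 - y` at `q` and of
`y` at `e` vanishes, provided that both are scalar. -/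
lemma eq_zero_or_eq_zero_of_norm_sub_halfStep {y e q : H →L[ℂ] H} (h₀ : 0 ≤ y) (h₁ : y ≤ 1)
    (he : IsStarProjection e) (hq : IsStarProjection q) (hqe : q * e = 0)
    {c d : ℂ} (hc : e * y * e = c • e) (hd : q * (1 - y) * q = d • q)
    (h : ‖y - halfStep e q‖ = 1) : d = 0 ∨ c = 0 := by
  by_contra! hcd
  have : Nontrivial (H →L[ℂ] H) := by
    by_contra hA
    rw [not_nontrivial_iff_subsingleton] at hA
    simp [Subsingleton.elim (y - halfStep e q) 0] at h
  refine IsSelfAdjoint.not_isUnit_and_isUnit_of_norm_eq_one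
    (h₀.isSelfAdjoint.sub (halfStep_nonneg he hq hqe).isSelfAdjoint) h ⟨?_, ?_⟩
  -- Here `d ≠ 0` makes the smaller element `1 - y + (1 / 2) • (1 - q)` invertible; `c ≠ 0` plays
  -- this role for the other sign.
  · refine isUnit_of_isUnit_of_le (add_nonneg (sub_nonneg.2 h₁) (smul_nonneg (by norm_num)
      hq.one_sub_nonneg)) (isUnit_add_half_one_sub (sub_nonneg.2 h₁)
      (sub_le_self _ h₀) hq hcd.1 hd) ?_
    rw [← sub_nonneg]
    have : 1 - (y - halfStep e q) - (1 - y + (1 / 2 : ℝ) • (1 - q)) = (1 / 2 : ℝ) • e := by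
      rw [halfStep]; module
    rw [this]
    exact smul_nonneg (by norm_num) he.nonneg
  · refine isUnit_of_isUnit_of_le (add_nonneg h₀ (smul_nonneg (by norm_num)
      he.one_sub_nonneg)) (isUnit_add_half_one_sub h₀ h₁ he hcd.2 hc) ?_
    rw [← sub_nonneg]
    have : 1 + (y - halfStep e q) - (y + (1 / 2 : ℝ) • (1 - e)) = (1 / 2 : ℝ) • q := by
      rw [halfStep]; module
    rw [this]
    exact smul_nonneg (by norm_num) hq.nonneg

/-- The set is cut out by the functionals `⟪adjoint w ζ, m η⟫`, ultraweakly continuous as given by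
sequences supported at index `0`. -/
lemma isClosed_ultraweak_setOf_mul_eq_zero (w : H →L[ℂ] H) :
    IsClosed[ultraweakTopology H] {m | w * m = 0} := by
  have hset : {m | w * m = 0} = ⋂ (ζ : H) (η : H),
      (fun m : H →L[ℂ] H => ∑' n, ⟪lp.single (E := fun _ : ℕ => H) 2 0 (adjoint w ζ) n,
        m (lp.single (E := fun _ : ℕ => H) 2 0 η n)⟫_ℂ) ⁻¹' {0} := by
    have key : ∀ (ζ η : H) (m : H →L[ℂ] H),
        ∑' n, ⟪lp.single (E := fun _ : ℕ => H) 2 0 (adjoint w ζ) n,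
          m (lp.single (E := fun _ : ℕ => H) 2 0 η n)⟫_ℂ = ⟪ζ, w (m η)⟫_ℂ := by
      intro ζ η m
      rw [tsum_eq_single 0]
      · simp [adjoint_inner_left]
      · intro n hn
        simp [hn]
    ext m
    simp only [Set.mem_ofPred_eq, Set.mem_iInter, Set.mem_preimage, Set.mem_singleton_iff, key]
    constructor
    · intro h ζ η
      have h' : w (m η) = 0 := congr($h η)
      rw [h', inner_zero_right]
    · intro h
      ext η
      exact inner_self_eq_zero.1 (h _ η)
  rw [hset]
  refine @isClosed_iInter _ _ (ultraweakTopology H) _ fun ζ =>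
    @isClosed_iInter _ _ (ultraweakTopology H) _ fun η => ?_
  refine @IsClosed.preimage _ _ (ultraweakTopology H) _ _ ?_ _ isClosed_singleton
  exact continuous_iInf_dom (i := lp.single (E := fun _ : ℕ => H) 2 0 (adjoint w ζ))
    (continuous_iInf_dom (i := lp.single (E := fun _ : ℕ => H) 2 0 η) continuous_induced_dom)

end Operator

/-! ### Minimal projections, atomicity and the double sphere. -/

namespace VonNeumannAlgebra

variable {H : Type*} [NormedAddCommGroup H] [InnerProductSpace ℂ H] [CompleteSpace H]
  {M : VonNeumannAlgebra H}

lemma smul_mem_complex (c : ℂ) {x : H →L[ℂ] H} (hx : x ∈ M) : c • x ∈ M :=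
  M.toStarSubalgebra.smul_mem hx c

lemma smul_mem_real (c : ℝ) {x : H →L[ℂ] H} (hx : x ∈ M) : c • x ∈ M :=
  smul_mem_complex (c : ℂ) hx

lemma halfStep_mem {e q : H →L[ℂ] H} (he : e ∈ M) (hq : q ∈ M) : halfStep e q ∈ M :=
  add_mem he (smul_mem_real _ (sub_mem (sub_mem (one_mem M) hq) he))

lemma IsMinimalProjection.exists_corner {p x : H →L[ℂ] H} (hp : M.IsMinimalProjection p)
    (hx : x ∈ M) : ∃ c : ℂ, p * x * p = c • p := by
  have : p * x * p ∈ Set.range fun c : ℂ => c • p := hp.corner_eq ▸ ⟨x, hx, rfl⟩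
  obtain ⟨c, hc⟩ := this
  exact ⟨c, hc.symm⟩

lemma isMinimalProjection_of_corner {p : H →L[ℂ] H} (hp : p ∈ M) (hpp : IsStarProjection p)
    (h0 : p ≠ 0) (h : ∀ x ∈ M, ∃ c : ℂ, p * x * p = c • p) : M.IsMinimalProjection p where
  mem := hp
  isStarProjection := hpp
  ne_zero := h0
  corner_eq := by
    ext z
    constructor
    · rintro ⟨x, hx, rfl⟩
      obtain ⟨c, hc⟩ := h x hx
      exact ⟨c, hc.symm⟩
    · rintro ⟨c, rfl⟩
      refine ⟨c • p, smul_mem_complex c hp, ?_⟩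
      simp [hpp.isIdempotentElem.eq]

/-- A minimal projection `f` with `r f ≠ 0` yields a minimal projection proportional to `r f r`. -/
lemma IsMinimalProjection.compress {f r : H →L[ℂ] H} (hf : M.IsMinimalProjection f)
    (hr : IsStarProjection r) (hrM : r ∈ M) (h : r * f ≠ 0) :
    ∃ c : ℂ, c ≠ 0 ∧ f * r * f = c • f ∧ M.IsMinimalProjection (c⁻¹ • (r * f * r)) := by
  obtain ⟨c, hc⟩ := hf.exists_corner hrM
  have hff := hf.isStarProjection.isIdempotentElem.eq
  have hrr := hr.isIdempotentElem.eq
  have hfs := hf.isStarProjection.isSelfAdjoint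
  have hrs := hr.isSelfAdjoint
  have hc0 : c ≠ 0 := by
    rintro rfl
    rw [zero_smul] at hc
    exact h (nonneg_mul_eq_zero_of_conj_eq_zero hr.nonneg hfs hc)
  have hcs : star c = c := by
    have h1 : star (f * r * f) = f * r * f := by
      simp [hfs.star_eq, hrs.star_eq, mul_assoc]
    rw [hc, star_smul, hfs.star_eq] at h1
    exact smul_left_injective ℂ hf.ne_zero h1
  have hsq : (r * f * r) * (r * f * r) = c • (r * f * r) := by
    calc (r * f * r) * (r * f * r) = r * (f * (r * r) * f) * r := by noncomm_ring
      _ = c • (r * f * r) := by rw [hrr, hc]; simp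
  refine ⟨c, hc0, hc, isMinimalProjection_of_corner ?_ ⟨?_, ?_⟩ ?_ ?_⟩
  · exact smul_mem_complex _ (mul_mem (mul_mem hrM hf.mem) hrM)
  · rw [IsIdempotentElem, smul_mul_smul_comm, hsq, smul_smul]
    congr 1
    field_simp
  · rw [IsSelfAdjoint, star_smul, star_inv₀, hcs]
    simp [hfs.star_eq, hrs.star_eq, mul_assoc]
  · intro h0
    rw [smul_eq_zero, inv_eq_zero, or_iff_right hc0] at h0
    have h1 : f * r * f * r * f = 0 := by
      rw [show f * r * f * r * f = f * (r * f * r) * f by noncomm_ring, h0, mul_zero, zero_mul]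
    rw [hc, smul_mul_assoc, smul_mul_assoc, hc, smul_smul, smul_eq_zero] at h1
    exact h1.elim (mul_ne_zero hc0 hc0) hf.ne_zero
  · intro x hx
    obtain ⟨d, hd⟩ := hf.exists_corner (mul_mem (mul_mem hrM hx) hrM)
    refine ⟨c⁻¹ * d, ?_⟩
    rw [smul_mul_assoc, smul_mul_assoc, mul_smul_comm]
    rw [show r * f * r * x * (r * f * r) = r * (f * (r * x * r) * f) * r by noncomm_ring, hd]
    simp only [mul_smul_comm, smul_mul_assoc, smul_smul]
    congr 1
    ring

/-- In an atomic algebra, an operator which vanishes on all minimal projections below `r`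
vanishes on `r`. -/
lemma IsAtomic.mul_eq_zero (hM : M.IsAtomic) {z r : H →L[ℂ] H} (hr : IsStarProjection r)
    (hrM : r ∈ M) (h : ∀ e, M.IsMinimalProjection e → r * e = e → z * e = 0) : z * r = 0 := by
  have hmin : ∀ f, M.IsMinimalProjection f → z * r * f = 0 := by
    intro f hf
    by_cases hrf : r * f = 0
    · rw [mul_assoc, hrf, mul_zero]
    obtain ⟨c, hc0, hc, hmin⟩ := hf.compress hr hrM hrf
    have h1 := h _ hmin (by
      rw [mul_smul_comm, ← mul_assoc, ← mul_assoc, hr.isIdempotentElem.eq])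
    rw [mul_smul_comm, smul_eq_zero, inv_eq_zero, or_iff_right hc0] at h1
    have h2 : c • (z * r * f) = 0 := by
      calc c • (z * r * f) = z * r * (f * r * f) := by rw [hc]; simp
        _ = z * (r * f * r) * f := by noncomm_ring
        _ = 0 := by rw [h1, zero_mul]
    exact (smul_eq_zero.1 h2).resolve_left hc0
  have hspan : ((Submodule.span ℂ {p | M.IsMinimalProjection p} : Submodule ℂ (H →L[ℂ] H)) :
      Set (H →L[ℂ] H)) ⊆ {m | z * r * m = 0} := by
    intro m hm
    induction hm using Submodule.span_induction with
    | mem x hx => exact hmin x hx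
    | zero => simp
    | add x y _ _ hx hy =>
      simp only [Set.mem_ofPred_eq] at hx hy ⊢
      rw [mul_add, hx, hy, add_zero]
    | smul c x _ hx =>
      simp only [Set.mem_ofPred_eq] at hx ⊢
      rw [mul_smul_comm, hx, smul_zero]
  have hcl := @closure_minimal _ (ultraweakTopology H) _ _ hspan
    (isClosed_ultraweak_setOf_mul_eq_zero (z * r))
  have h1 : (1 : H →L[ℂ] H) ∈ (M : Set (H →L[ℂ] H)) := one_mem M
  -- The annihilator of `z * r` is ultraweakly closed and contains the span, so by atomicity it
  -- contains `1`.
  rw [hM] at h1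
  simpa using hcl h1

lemma le_one_of_mem_positiveUnitSphere {x : H →L[ℂ] H} (hx : x ∈ M.positiveUnitSphere) : x ≤ 1 :=
  (CStarAlgebra.norm_le_one_iff_of_nonneg x hx.2.1).1 hx.2.2.le

lemma mem_sphPos_singleton {x a : H →L[ℂ] H} :
    x ∈ M.sphPos {a} ↔ x ∈ M.positiveUnitSphere ∧ ‖x - a‖ = 1 := by
  simp [sphPos, unitSphereAround]

lemma mem_sphPos_sphPos_self {a : H →L[ℂ] H} (ha : a ∈ M.positiveUnitSphere) :
    a ∈ M.sphPos (M.sphPos {a}) :=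
  ⟨ha, fun b hb => by rw [norm_sub_rev]; exact (mem_sphPos_singleton.1 hb).2⟩

lemma sq_mem_sphPos_sphPos {a : H →L[ℂ] H} (ha : a ∈ M.positiveUnitSphere) :
    a ^ 2 ∈ M.sphPos (M.sphPos {a}) := by
  refine ⟨⟨pow_mem ha.1 2, CStarAlgebra.pow_nonneg ha.2.1 2, ?_⟩, fun x hx => ?_⟩
  · have := CStarRing.norm_star_mul_self (x := a)
    rw [ha.2.1.isSelfAdjoint.star_eq, ha.2.2] at this
    rw [pow_two, this, one_mul]
  · obtain ⟨hx, hxa⟩ := mem_sphPos_singleton.1 hx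
    rw [norm_sub_rev]
    exact norm_sub_sq_eq_one hx.2.1 (le_one_of_mem_positiveUnitSphere hx) ha.2.1
      (le_one_of_mem_positiveUnitSphere ha) hxa

lemma halfStep_mem_positiveUnitSphere {e q : H →L[ℂ] H} (he : IsStarProjection e) (heM : e ∈ M)
    (h0 : e ≠ 0) (hq : IsStarProjection q) (hqM : q ∈ M) (hqe : q * e = 0) :
    halfStep e q ∈ M.positiveUnitSphere := by
  have hx := halfStep_nonneg he hq hqe
  exact ⟨halfStep_mem heM hqM, hx,
    ((CStarAlgebra.norm_le_one_iff_of_nonneg _ hx).2 (halfStep_le_one he hq)).antisymm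
      (one_le_norm_of_mul_eq h0 (halfStep_mul_left he hqe))⟩

lemma halfStep_mem_sphPos_of_mul_left {p e q : H →L[ℂ] H} (hp : IsStarProjection p)
    (he : IsStarProjection e) (heM : e ∈ M) (h0 : e ≠ 0) (hq : IsStarProjection q) (hqM : q ∈ M)
    (hqe : q * e = 0) (hpe : p * e = 0) : halfStep e q ∈ M.sphPos {p} := by
  refine mem_sphPos_singleton.2 ⟨halfStep_mem_positiveUnitSphere he heM h0 hq hqM hqe,
    (norm_sub_le_one (halfStep_nonneg he hq hqe) (halfStep_le_one he hq) hp.nonneg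
      hp.le_one).antisymm (one_le_norm_of_mul_eq h0 ?_)⟩
  rw [sub_mul, halfStep_mul_left he hqe, hpe, sub_zero]

/-- The difference `p - halfStep e q` fixes `q`, so its norm is at least one. -/
lemma halfStep_mem_sphPos_of_mul_right {p e q : H →L[ℂ] H} (hp : IsStarProjection p)
    (he : IsStarProjection e) (heM : e ∈ M) (h0 : e ≠ 0) (hq : IsStarProjection q) (hqM : q ∈ M)
    (hq0 : q ≠ 0) (hqe : q * e = 0) (hpq : p * q = q) : halfStep e q ∈ M.sphPos {p} := by
  have heq : e * q = 0 := by
    simpa [he.isSelfAdjoint.star_eq, hq.isSelfAdjoint.star_eq] using congr(star $hqe)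
  refine mem_sphPos_singleton.2 ⟨halfStep_mem_positiveUnitSphere he heM h0 hq hqM hqe,
    (norm_sub_le_one (halfStep_nonneg he hq hqe) (halfStep_le_one he hq) hp.nonneg
      hp.le_one).antisymm ?_⟩
  rw [norm_sub_rev]
  refine one_le_norm_of_mul_eq hq0 ?_
  rw [sub_mul, halfStep_mul_right hq heq, hpq, sub_zero]

lemma mul_eq_zero_of_mem_sphPos_sphPos {p y e : H →L[ℂ] H} (hp : IsStarProjection p)
    (hy : y ∈ M.sphPos (M.sphPos {p})) (he : M.IsMinimalProjection e) (hpe : p * e = 0) :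
    y * e = 0 := by
  have hx := halfStep_mem_sphPos_of_mul_left hp he.isStarProjection he.mem he.ne_zero
    (.zero _) (zero_mem M) (zero_mul e) hpe
  obtain ⟨c, hc⟩ := he.exists_corner hy.1.1
  -- For `q = 0` the corner equation holds with any `d`; choosing `d = 1` excludes the first
  -- alternative.
  have hc0 := (eq_zero_or_eq_zero_of_norm_sub_halfStep hy.1.2.1
    (le_one_of_mem_positiveUnitSphere hy.1) he.isStarProjection (.zero _) (zero_mul e) hc
    (d := 1) (by simp) (hy.2 _ hx)).resolve_left one_ne_zero
  rw [hc0, zero_smul] at hc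
  exact nonneg_mul_eq_zero_of_conj_eq_zero hy.1.2.1 he.isStarProjection.isSelfAdjoint hc

lemma mul_eq_self_or_mul_eq_zero_of_mem_sphPos_sphPos {p y e q : H →L[ℂ] H}
    (hp : IsStarProjection p) (hy : y ∈ M.sphPos (M.sphPos {p})) (he : M.IsMinimalProjection e)
    (hq : M.IsMinimalProjection q) (hqe : q * e = 0) (hpq : p * q = q) :
    y * q = q ∨ y * e = 0 := by
  have hx := halfStep_mem_sphPos_of_mul_right hp he.isStarProjection he.mem he.ne_zero
    hq.isStarProjection hq.mem hq.ne_zero hqe hpq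
  have hy₁ := le_one_of_mem_positiveUnitSphere hy.1
  obtain ⟨c, hc⟩ := he.exists_corner hy.1.1
  obtain ⟨d, hd⟩ := hq.exists_corner (sub_mem (one_mem M) hy.1.1)
  rcases eq_zero_or_eq_zero_of_norm_sub_halfStep hy.1.2.1 hy₁ he.isStarProjection
    hq.isStarProjection hqe hc hd (hy.2 _ hx) with h | h
  · rw [h, zero_smul] at hd
    have := nonneg_mul_eq_zero_of_conj_eq_zero (sub_nonneg.2 hy₁)
      hq.isStarProjection.isSelfAdjoint hd
    rw [sub_mul, one_mul, sub_eq_zero] at this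
    exact .inl this.symm
  · rw [h, zero_smul] at hc
    exact .inr
      (nonneg_mul_eq_zero_of_conj_eq_zero hy.1.2.1 he.isStarProjection.isSelfAdjoint hc)

open scoped ComplexOrder in
-- Here `y = q * y * q` is a multiple `c • q`; positivity and norm one force `c = 1`.
lemma IsMinimalProjection.eq_of_mem_positiveUnitSphere {q y : H →L[ℂ] H}
    (hq : M.IsMinimalProjection q) (hy : y ∈ M.positiveUnitSphere) (h : y * q = y) : y = q := by
  have hq' : q * y = y := by
    simpa [hq.isStarProjection.isSelfAdjoint.star_eq, hy.2.1.isSelfAdjoint.star_eq]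
      using congr(star $h)
  obtain ⟨c, hc⟩ := hq.exists_corner hy.1
  rw [hq', h] at hc
  have hqn : ‖q‖ = 1 :=
    ((CStarAlgebra.norm_le_one_iff_of_nonneg q hq.isStarProjection.nonneg).2
      hq.isStarProjection.le_one).antisymm
      (one_le_norm_of_mul_eq hq.ne_zero hq.isStarProjection.isIdempotentElem.eq)
  have hcn : ‖c‖ = 1 := by
    have := hy.2.2
    rwa [hc, norm_smul, hqn, mul_one] at this
  have hc0 : 0 ≤ c := by
    have hpos := hy.2.1
    rw [hc, nonneg_iff_isPositive, ← isPositive_toLinearMap_iff, toLinearMap_smul] at hpos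
    have hqpos := (isPositive_toLinearMap_iff q).2
      ((nonneg_iff_isPositive q).1 hq.isStarProjection.nonneg)
    exact (LinearMap.IsPositive.isPositive_smul_iff hqpos
      fun h' => hq.ne_zero (coe_injective h')).1 hpos
  have : c = 1 := by
    rw [Complex.eq_coe_norm_of_nonneg hc0, hcn, Complex.ofReal_one]
  rw [hc, this, one_smul]

lemma IsAtomic.eq_of_mem_sphPos_sphPos (hM : M.IsAtomic) {p y : H →L[ℂ] H}
    (hp : IsStarProjection p) (hpM : p ∈ M) (hy : y ∈ M.sphPos (M.sphPos {p})) : y = p := by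
  have hyp : y * p = y := by
    have := hM.mul_eq_zero hp.one_sub (sub_mem (one_mem M) hpM) fun e he hpe =>
      mul_eq_zero_of_mem_sphPos_sphPos hp hy he (by simpa [sub_mul] using hpe)
    rw [mul_sub, mul_one, sub_eq_zero] at this
    exact this.symm
  have hmin : ∀ q, M.IsMinimalProjection q → p * q = q → y * q = q := by
    intro q hq hpq
    by_contra hyq
    have hr : IsStarProjection (p - q) :=
      hq.isStarProjection.sub_of_mul_eq_right hp hpq
    have h0 : y * (p - q) = 0 := by
      refine hM.mul_eq_zero hr (sub_mem hpM hq.mem) fun e he hre => ?_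
      refine (mul_eq_self_or_mul_eq_zero_of_mem_sphPos_sphPos hp hy he hq ?_ hpq).resolve_left hyq
      have hqp : q * p = q := by
        simpa [hp.isSelfAdjoint.star_eq, hq.isStarProjection.isSelfAdjoint.star_eq]
          using congr(star $hpq)
      rw [← hre, ← mul_assoc, mul_sub, hqp, hq.isStarProjection.isIdempotentElem.eq, sub_self,
        zero_mul]
    rw [mul_sub, hyp, sub_eq_zero] at h0
    have := hq.eq_of_mem_positiveUnitSphere hy.1 h0.symm
    exact hyq (this ▸ hq.isStarProjection.isIdempotentElem.eq)
  have h1 := hM.mul_eq_zero (z := 1 - y) hp hpM fun q hq hpq => by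
    rw [sub_mul, one_mul, hmin q hq hpq, sub_self]
  rw [sub_mul, one_mul, hyp, sub_eq_zero] at h1
  exact h1.symm

end VonNeumannAlgebra

theorem mainTheorem1 {H : Type*} [NormedAddCommGroup H] [InnerProductSpace ℂ H] [CompleteSpace H]
    (M : VonNeumannAlgebra H) (hM : M.IsAtomic)
    (a : H →L[ℂ] H) (haM : a ∈ M) (ha_pos : 0 ≤ a) (ha_norm : ‖a‖ = 1) :
    IsStarProjection a ↔ M.sphPos (M.sphPos {a}) = {a} := by
  have ha : a ∈ M.positiveUnitSphere := ⟨haM, ha_pos, ha_norm⟩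
  constructor
  · intro hp
    exact Set.Subset.antisymm (fun y hy => hM.eq_of_mem_sphPos_sphPos hp haM hy)
      (Set.singleton_subset_iff.2 (VonNeumannAlgebra.mem_sphPos_sphPos_self ha))
  · intro h
    have hsq := VonNeumannAlgebra.sq_mem_sphPos_sphPos ha
    rw [h, Set.mem_singleton_iff, pow_two] at hsq
    exact ⟨hsq, ha_pos.isSelfAdjoint⟩
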